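/- All graphs are finite and simple. A biclique on a vertex set $V$ is a complete bipartite graph whose two parts are disjoint subsets of $V$. An odd cover of a graph $G$ is a finite collection of bicliques on $V(G)$ such that each edge of $G$ lies in an odd number of them and each pair of distinct nonadjacent vertices of $G$ is joined in an even number of them; $b_2(G)$ is the minimum cardinality of an odd cover of $G$. Let $r_2(G)$ denote the rank over $\mathbb{F}_2$ of the adjacency matrix of $G$, let $C_k$ ($k\ge 3$) denote the cycle on $k$ vertices, and let $+$ denote disjoint union. Theorem. Let $t\ge 1$ and $\ell\ge 0$ be integers, let $n_1,\dots,n_t\ge 1$ and $m_1,\dots,m_\ell\ge 2$ be integers, and let $$G=C_{2n_1+1}+\dots+C_{2n_t+1}+C_{2m_1}+\dots+C_{2m_\ell}.$$ Then $$b_2(G)=\sum_{i=1}^t n_i+\sum_{j=1}^{\ell} m_j-\ell+1,\qquad\text{and}\qquad b_2(G)=\frac{r_2(G)}{2}+1 .$$ -/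

import Mathlib

namespace OddCover

/-- A biclique (complete bipartite graph) on a subset of the vertex set `V`, given by its two
disjoint parts. A biclique with an empty part has no edges. -/
structure Biclique (V : Type*) where
  left : Set V
  right : Set V
  disjoint : Disjoint left right

/-- The pair `u, v` is an edge of the biclique. -/
def Biclique.Covers {V : Type*} (B : Biclique V) (u v : V) : Prop :=
  (u ∈ B.left ∧ v ∈ B.right) ∨ (v ∈ B.left ∧ u ∈ B.right)

/-- A collection of `k` bicliques is an odd cover of `G` if each edge of `G` is covered an odd
number of times and each nonedge of `G` (pair of distinct nonadjacent vertices) is covered an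
even number of times. -/
def IsOddCover {V : Type*} (G : SimpleGraph V) {k : ℕ} (B : Fin k → Biclique V) : Prop :=
  (∀ u v : V, G.Adj u v → Odd {i : Fin k | (B i).Covers u v}.ncard) ∧
    (∀ u v : V, u ≠ v → ¬ G.Adj u v → Even {i : Fin k | (B i).Covers u v}.ncard)

/-- `b₂(G)`: the minimum cardinality of an odd cover of the finite graph `G`. -/
noncomputable def b2 {V : Type*} [Finite V] (G : SimpleGraph V) : ℕ :=
  sInf {k : ℕ | ∃ B : Fin k → Biclique V, IsOddCover G B}

open Classical in
/-- `r₂(G)`: the rank over `𝔽₂` of the adjacency matrix of `G`. -/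
noncomputable def r2 {V : Type*} [Fintype V] (G : SimpleGraph V) : ℕ :=
  (G.adjMatrix (ZMod 2)).rank

/-- The disjoint union of an indexed family of graphs, on the disjoint union of the vertex sets. -/
def disjointUnion {ι : Type*} {V : ι → Type*} (G : ∀ i, SimpleGraph (V i)) :
    SimpleGraph (Σ i, V i) where
  Adj x y := ∃ i, ∃ u v : V i, (G i).Adj u v ∧ x = ⟨i, u⟩ ∧ y = ⟨i, v⟩
  symm := ⟨fun _ _ ⟨i, u, v, h, hx, hy⟩ => ⟨i, v, u, h.symm, hy, hx⟩⟩
  loopless := ⟨by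
    rintro x ⟨i, u, v, h, hx, hy⟩
    have huv : u = v := by
      have := hx.symm.trans hy
      simpa using this
    exact h.ne huv⟩

/-- The disjoint union of the odd cycles `C_{2 n_i + 1}` and the even cycles `C_{2 m_j}`. -/
def cycleUnion {t l : ℕ} (n : Fin t → ℕ) (m : Fin l → ℕ) :
    SimpleGraph ((Σ i : Fin t, Fin (2 * n i + 1)) ⊕ (Σ j : Fin l, Fin (2 * m j))) :=
  disjointUnion (fun i => SimpleGraph.cycleGraph (2 * n i + 1)) ⊕g
    disjointUnion (fun j => SimpleGraph.cycleGraph (2 * m j))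

end OddCover

/-! Over `ZMod 2` an odd cover with parts `L_i`, `R_i` writes the adjacency matrix as `A = ∑ (L_i
R_iᵀ + R_i L_iᵀ)`, so the kernel of `A` contains every vector orthogonal to all parts.

Lower bound: the `2k` parts span at most `2k` dimensions, so `rank A ≤ 2k`. If equality held, the
two kernels would agree. The indicator of an odd cycle lies in `ker A`, so every part would meet
that cycle in an even set and the bicliques would cover its pairs an even number of times in total.
But the cycle has oddly many edges. Hence `r2 G < 2 * k` (`IsOddCover.r2_lt`). Alternation around
each cycle gives kernel dimension 1 for odd cycles and 2 for even ones, hence the rank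
(`r2_cycleUnion`).

Upper bound: four-cycles, which are bicliques, reduce an odd cycle to a triangle and an even cycle
to nothing. The `t` triangles then cost `t + 1` bicliques altogether: one per triangle and one
shared (`coverSum_cycleCover_eq`). -/

namespace OddCover

/-! ### Indicators and odd covers over `ZMod 2` -/

/-- The `𝔽₂`-valued indicator of a proposition. -/
noncomputable def ind (p : Prop) : ZMod 2 := open Classical in if p then 1 else 0

theorem ind_true {p : Prop} (h : p) : ind p = 1 := if_pos h

theorem ind_false {p : Prop} (h : ¬ p) : ind p = 0 := if_neg h

theorem ind_congr {p q : Prop} (h : p ↔ q) : ind p = ind q := by rw [propext h]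

theorem ind_or {p q : Prop} (h : p → ¬ q) : ind (p ∨ q) = ind p + ind q := by
  unfold ind; by_cases hp : p <;> by_cases hq : q <;> simp_all

theorem ind_and (p q : Prop) : ind (p ∧ q) = ind p * ind q := by
  unfold ind; by_cases hp : p <;> by_cases hq : q <;> simp_all

theorem ind_not (p : Prop) : ind (¬ p) = 1 - ind p := by
  unfold ind; by_cases hp : p <;> simp_all

theorem two_eq_zero : (2 : ZMod 2) = 0 := rfl

theorem Biclique.ind_left_mul_ind_right {V : Type*} (B : Biclique V) (v : V) :
    ind (v ∈ B.left) * ind (v ∈ B.right) = 0 := by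
  rw [← ind_and]
  exact ind_false fun h => Set.disjoint_left.1 B.disjoint h.1 h.2

theorem Biclique.ind_covers {V : Type*} (B : Biclique V) (u v : V) :
    ind (B.Covers u v) =
      ind (u ∈ B.left) * ind (v ∈ B.right) + ind (v ∈ B.left) * ind (u ∈ B.right) := by
  unfold Biclique.Covers
  rw [ind_or, ind_and, ind_and]
  exact fun h h' => Set.disjoint_left.1 B.disjoint h.1 h'.2

theorem sum_ind_eq_ncard {ι : Type*} [Fintype ι] (p : ι → Prop) :
    ∑ i, ind (p i) = ({i | p i}.ncard : ZMod 2) := by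
  classical
  have : {i | p i} = ((Finset.univ.filter p : Finset ι) : Set ι) := by ext; simp
  rw [this, Set.ncard_coe_finset, Finset.natCast_card_filter]
  exact Finset.sum_congr rfl fun i _ => by unfold ind; congr

theorem sum_ind_eq_mul {ι : Type*} (s : Finset ι) (a : ι) (f : ι → ZMod 2) :
    ∑ i ∈ s, ind (i = a) * f i = ind (a ∈ s) * f a := by
  by_cases ha : a ∈ s
  · rw [Finset.sum_eq_single_of_mem a ha, ind_true rfl, ind_true ha]
    exact fun i _ hi => by rw [ind_false hi, zero_mul]
  · rw [ind_false ha, zero_mul]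
    exact Finset.sum_eq_zero fun i hi => by
      rw [ind_false (ne_of_mem_of_not_mem hi ha), zero_mul]

/-- The `𝔽₂`-valued number of bicliques of a family that cover the pair `u, v`. -/
noncomputable def coverSum {V ι : Type*} [Fintype ι] (B : ι → Biclique V) (u v : V) : ZMod 2 :=
  ∑ i, (ind (u ∈ (B i).left) * ind (v ∈ (B i).right) +
    ind (v ∈ (B i).left) * ind (u ∈ (B i).right))

theorem isOddCover_iff {V : Type*} (G : SimpleGraph V) {k : ℕ} (B : Fin k → Biclique V) :
    IsOddCover G B ↔ ∀ u v, u ≠ v → coverSum B u v = ind (G.Adj u v) := by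
  have key : ∀ u v, coverSum B u v = ({i : Fin k | (B i).Covers u v}.ncard : ZMod 2) := by
    intro u v
    rw [← sum_ind_eq_ncard]
    exact Finset.sum_congr rfl fun i _ => ((B i).ind_covers u v).symm
  simp only [key]
  constructor
  · rintro ⟨h1, h2⟩ u v huv
    by_cases h : G.Adj u v
    · rw [ind_true h]; exact (ZMod.natCast_eq_one_iff_odd).2 (h1 u v h)
    · rw [ind_false h]; exact (ZMod.natCast_eq_zero_iff_even).2 (h2 u v huv h)
  · intro h
    refine ⟨fun u v huv => ?_, fun u v hne huv => ?_⟩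
    · rw [← ZMod.natCast_eq_one_iff_odd, h u v huv.ne, ind_true huv]
    · rw [← ZMod.natCast_eq_zero_iff_even, h u v hne, ind_false huv]

theorem exists_isOddCover_of_coverSum {V ι : Type*} [Fintype ι] (G : SimpleGraph V)
    (B : ι → Biclique V) (h : ∀ u v, u ≠ v → coverSum B u v = ind (G.Adj u v)) :
    ∃ B : Fin (Fintype.card ι) → Biclique V, IsOddCover G B := by
  refine ⟨B ∘ (Fintype.equivFin ι).symm, (isOddCover_iff _ _).2 fun u v huv => ?_⟩
  rw [← h u v huv]
  exact Equiv.sum_comp (Fintype.equivFin ι).symm fun i =>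
    (ind (u ∈ (B i).left) * ind (v ∈ (B i).right) +
      ind (v ∈ (B i).left) * ind (u ∈ (B i).right))

/-! ### Cycles -/

/-- The indicator of the edge `a b`, as a function of two natural numbers. -/
noncomputable def edge (a b u v : ℕ) : ZMod 2 :=
  ind (u = a) * ind (v = b) + ind (v = a) * ind (u = b)

theorem sum_range_edge {N u v : ℕ} (hu : u ≤ N) (hv : v ≤ N) :
    ∑ j ∈ Finset.range N, edge j (j + 1) u v = ind (v = u + 1) + ind (u = v + 1) := by
  have aux : ∀ {u v : ℕ}, v ≤ N →
      ∑ j ∈ Finset.range N, ind (u = j) * ind (v = j + 1) = ind (v = u + 1) := by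
    intro u v hv
    unfold ind
    simp only [ite_mul, one_mul, zero_mul, Finset.sum_ite_eq, Finset.mem_range]
    split_ifs <;> first | rfl | omega
  unfold edge
  rw [Finset.sum_add_distrib, aux hv, aux hu]

theorem cycleGraph_adj_iff {k : ℕ} (hk : 3 ≤ k) (u v : Fin k) :
    (SimpleGraph.cycleGraph k).Adj u v ↔
      (v : ℕ) = u + 1 ∨ (u : ℕ) = v + 1 ∨ ((u : ℕ) = 0 ∧ (v : ℕ) = k - 1) ∨
        ((v : ℕ) = 0 ∧ (u : ℕ) = k - 1) := by
  rw [SimpleGraph.cycleGraph_adj']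
  have := u.2
  have := v.2
  rcases lt_trichotomy u v with h | rfl | h
  · have h1 := Fin.coe_sub_iff_lt.2 h
    have h2 := Fin.coe_sub_iff_le.2 h.le
    rw [Fin.lt_def] at h
    omega
  · have h1 := Fin.coe_sub_iff_le.2 (le_refl u)
    omega
  · have h1 := Fin.coe_sub_iff_lt.2 h
    have h2 := Fin.coe_sub_iff_le.2 h.le
    rw [Fin.lt_def] at h
    omega

theorem ind_cycleGraph_adj {k : ℕ} (hk : 3 ≤ k) (u v : Fin k) :
    ind ((SimpleGraph.cycleGraph k).Adj u v) =
      ∑ j ∈ Finset.range (k - 1), edge j (j + 1) u v + edge 0 (k - 1) u v := by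
  have := u.2
  have := v.2
  rw [sum_range_edge (by omega) (by omega), ind_congr (cycleGraph_adj_iff hk u v)]
  unfold edge
  rw [ind_or (by omega), ind_or (by omega), ind_or (by omega), ind_and, ind_and]
  ring

/-- The indicator of the four-cycle `0, a, a + 1, a + 2`. -/
noncomputable def fourCycle (a u v : ℕ) : ZMod 2 :=
  (ind (u = 0) + ind (u = a + 1)) * (ind (v = a) + ind (v = a + 2)) +
    (ind (v = 0) + ind (v = a + 1)) * (ind (u = a) + ind (u = a + 2))

theorem fourCycle_eq (a u v : ℕ) : fourCycle a u v =
    edge a (a + 1) u v + edge (a + 1) (a + 2) u v + edge 0 (a + 2) u v + edge 0 a u v := by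
  unfold fourCycle edge; ring

/-- Each four-cycle shares the chord `0, a` with the polygon built so far; adding it modulo 2 trades
that chord for a longer path. The start is the triangle `0, 1, 2`. -/
theorem sum_fourCycle_odd (p u v : ℕ) :
    edge 0 1 u v + edge 1 2 u v + edge 0 2 u v +
        ∑ s ∈ Finset.range p, fourCycle (2 * s + 2) u v =
      ∑ j ∈ Finset.range (2 * p + 2), edge j (j + 1) u v + edge 0 (2 * p + 2) u v := by
  induction p with
  | zero => simp [Finset.sum_range_succ]
  | succ p ih =>
    rw [Finset.sum_range_succ, ← add_assoc, ih, fourCycle_eq,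
      show 2 * (p + 1) + 2 = 2 * p + 2 + 1 + 1 by ring, Finset.sum_range_succ _ (2 * p + 2 + 1),
      Finset.sum_range_succ _ (2 * p + 2)]
    linear_combination edge 0 (2 * p + 2) u v * two_eq_zero

/-- The same growth, started from the degenerate 2-gon, whose doubled edge `0, 1` vanishes modulo 2.
-/
theorem sum_fourCycle_even (p u v : ℕ) :
    ∑ s ∈ Finset.range p, fourCycle (2 * s + 1) u v =
      ∑ j ∈ Finset.range (2 * p + 1), edge j (j + 1) u v + edge 0 (2 * p + 1) u v := by
  induction p with
  | zero =>
    simp only [Finset.range_zero, Finset.sum_empty, mul_zero, zero_add, Finset.sum_range_one]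
    linear_combination -edge 0 1 u v * two_eq_zero
  | succ p ih =>
    rw [Finset.sum_range_succ, ih, fourCycle_eq,
      show 2 * (p + 1) + 1 = 2 * p + 1 + 1 + 1 by ring, Finset.sum_range_succ _ (2 * p + 1 + 1),
      Finset.sum_range_succ _ (2 * p + 1)]
    linear_combination edge 0 (2 * p + 1) u v * two_eq_zero

/-! ### Counting edges modulo 2 -/

open Matrix

/-- Left-to-right incidences form a nonsymmetric `g`; summing it over ordered pairs counts each
unordered pair by the symmetric weight `a`. -/
theorem sum_eq_sum_ind_lt {n : ℕ} (g a : Fin n → Fin n → ZMod 2) (hd : ∀ u, g u u = 0)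
    (ha : ∀ u v, g u v + g v u = a u v) :
    ∑ u, ∑ v, g u v = ∑ u : Fin n, ∑ v : Fin n, ind (u < v) * a u v := by
  have h1 : ∀ u v, g u v = ind (u < v) * g u v + ind (v < u) * g u v := by
    intro u v
    rcases lt_trichotomy u v with h | rfl | h
    · rw [ind_true h, ind_false h.asymm]; ring
    · rw [hd]; ring
    · rw [ind_true h, ind_false h.asymm]; ring
  calc ∑ u, ∑ v, g u v
      = ∑ u : Fin n, ∑ v : Fin n, (ind (u < v) * g u v + ind (v < u) * g u v) :=
        Finset.sum_congr rfl fun u _ => Finset.sum_congr rfl fun v _ => h1 u v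
    _ = ∑ u : Fin n, ∑ v : Fin n, ind (u < v) * g u v
        + ∑ v : Fin n, ∑ u : Fin n, ind (v < u) * g u v := by
        rw [Finset.sum_comm (f := fun v u : Fin n => ind (v < u) * g u v)]
        simp only [Finset.sum_add_distrib]
    _ = _ := by
        rw [← Finset.sum_add_distrib]
        refine Finset.sum_congr rfl fun u _ => ?_
        rw [← Finset.sum_add_distrib]
        refine Finset.sum_congr rfl fun v _ => ?_
        rw [← ha]; ring

theorem sum_ind_eq_val (k a : ℕ) : ∑ v : Fin k, ind ((v : ℕ) = a) = ind (a < k) := by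
  rw [Fin.sum_univ_eq_sum_range (fun v => ind (v = a)) k]
  have := sum_ind_eq_mul (Finset.range k) a fun _ => 1
  simpa only [mul_one, Finset.mem_range] using this

/-- A cycle of length `k` has `k` edges. -/
theorem sum_ind_lt_mul_cycleGraph_adj {k : ℕ} (hk : 3 ≤ k) :
    ∑ u : Fin k, ∑ v : Fin k, ind (u < v) * ind ((SimpleGraph.cycleGraph k).Adj u v) = k := by
  have h1 : ∀ u v : Fin k, ind (u < v) * ind ((SimpleGraph.cycleGraph k).Adj u v) =
      ind ((v : ℕ) = u + 1) + ind ((u : ℕ) = 0) * ind ((v : ℕ) = k - 1) := by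
    intro u v
    rw [← ind_and, ← ind_and, ← ind_or (by omega), cycleGraph_adj_iff hk]
    refine ind_congr ?_
    rw [Fin.lt_def]
    omega
  simp only [h1, Finset.sum_add_distrib]
  simp only [← Finset.mul_sum, sum_ind_eq_val]
  rw [ind_true (show k - 1 < k by omega), ← Finset.sum_mul, sum_ind_eq_val,
    ind_true (show 0 < k by omega), Fin.sum_univ_eq_sum_range (fun u => ind (u + 1 < k)) k]
  obtain ⟨N, rfl⟩ : ∃ N, k = N + 1 := ⟨k - 1, by omega⟩
  rw [Finset.sum_range_succ, ind_false (by omega)]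
  rw [Finset.sum_congr rfl fun u hu => ind_true (show u + 1 < N + 1 by
    have := Finset.mem_range.1 hu; omega)]
  simp

/-! ### Rank lower bound -/

section LowerBound

variable {V : Type*} [Fintype V] {k : ℕ}

/-- The linear map whose components are the incidence vectors of the parts of the bicliques. -/
noncomputable def partsMap (B : Fin k → Biclique V) :
    (V → ZMod 2) →ₗ[ZMod 2] (Fin k ⊕ Fin k → ZMod 2) :=
  Matrix.mulVecLin (Matrix.of fun i v =>
    Sum.elim (fun i => ind (v ∈ (B i).left)) (fun i => ind (v ∈ (B i).right)) i)

theorem partsMap_inl (B : Fin k → Biclique V) (f : V → ZMod 2) (i : Fin k) :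
    partsMap B f (Sum.inl i) = ∑ v, ind (v ∈ (B i).left) * f v := by
  simp [partsMap, Matrix.mulVec, dotProduct]

theorem partsMap_inr (B : Fin k → Biclique V) (f : V → ZMod 2) (i : Fin k) :
    partsMap B f (Sum.inr i) = ∑ v, ind (v ∈ (B i).right) * f v := by
  simp [partsMap, Matrix.mulVec, dotProduct]

omit [Fintype V] in
-- Disjointness of the parts makes the diagonal vanish too, so this is a genuine matrix identity.
theorem IsOddCover.coverSum_eq {G : SimpleGraph V} {B : Fin k → Biclique V}
    (hB : IsOddCover G B) (u v : V) : coverSum B u v = ind (G.Adj u v) := by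
  rcases eq_or_ne u v with rfl | h
  · rw [ind_false (G.loopless.irrefl u)]
    refine Finset.sum_eq_zero fun i _ => ?_
    rw [(B i).ind_left_mul_ind_right, add_zero]
  · exact (isOddCover_iff G B).1 hB u v h

open Classical in
theorem adjMatrix_mulVec_apply (G : SimpleGraph V) (f : V → ZMod 2) (u : V) :
    (G.adjMatrix (ZMod 2) *ᵥ f) u = ∑ v, ind (G.Adj u v) * f v := by
  simp only [Matrix.mulVec, dotProduct, SimpleGraph.adjMatrix_apply]
  exact Finset.sum_congr rfl fun v _ => by unfold ind; congr

open Classical in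
-- By the matrix identity, `A f` depends only on the pairings of `f` with the parts.
theorem IsOddCover.ker_partsMap_le {G : SimpleGraph V} {B : Fin k → Biclique V}
    (hB : IsOddCover G B) :
    LinearMap.ker (partsMap B) ≤ LinearMap.ker (G.adjMatrix (ZMod 2)).mulVecLin := by
  intro f hf
  rw [LinearMap.mem_ker] at hf ⊢
  ext u
  rw [Matrix.mulVecLin_apply, adjMatrix_mulVec_apply]
  have : ∑ v, ind (G.Adj u v) * f v = ∑ i, (ind (u ∈ (B i).left) * partsMap B f (Sum.inr i) +
      ind (u ∈ (B i).right) * partsMap B f (Sum.inl i)) := by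
    simp only [partsMap_inl, partsMap_inr, Finset.mul_sum, ← Finset.sum_add_distrib]
    rw [Finset.sum_comm]
    refine Finset.sum_congr rfl fun v _ => ?_
    rw [← hB.coverSum_eq, coverSum, Finset.sum_mul]
    exact Finset.sum_congr rfl fun i _ => by ring
  simp [this, hf]

/-- The parts map has rank at most `2 * k ≤ r2 G`, so by rank-nullity its kernel is no smaller than
that of `A`, and the inclusion is an equality. -/
theorem IsOddCover.partsMap_eq_zero {G : SimpleGraph V} {B : Fin k → Biclique V}
    (hB : IsOddCover G B) (hk : 2 * k ≤ r2 G) {f : V → ZMod 2}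
    (hf : ∀ u, ∑ v, ind (G.Adj u v) * f v = 0) : partsMap B f = 0 := by
  classical
  have h1 := LinearMap.finrank_range_add_finrank_ker (partsMap B)
  have h2 := LinearMap.finrank_range_add_finrank_ker (G.adjMatrix (ZMod 2)).mulVecLin
  have h3 : Module.finrank (ZMod 2) (LinearMap.range (partsMap B)) ≤ 2 * k := by
    refine (Submodule.finrank_le _).trans ?_
    rw [Module.finrank_pi]
    simp; omega
  have h4 : 2 * k ≤ Module.finrank (ZMod 2)
      (LinearMap.range (G.adjMatrix (ZMod 2)).mulVecLin) := by
    unfold r2 Matrix.rank at hk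
    convert hk
  have h5 := Submodule.eq_of_le_of_finrank_le hB.ker_partsMap_le (by omega)
  rw [← LinearMap.mem_ker, h5, LinearMap.mem_ker]
  ext u
  rw [Matrix.mulVecLin_apply, adjMatrix_mulVec_apply, hf, Pi.zero_apply]

/-- Here `c` is an induced odd cycle, and `hzc` says that `z` is its indicator. -/
theorem IsOddCover.r2_lt {G : SimpleGraph V} {B : Fin k → Biclique V} (hB : IsOddCover G B)
    {n : ℕ} (hn : 1 ≤ n) (c : Fin (2 * n + 1) → V) (z : V → ZMod 2)
    (hz : ∀ u, ∑ v, ind (G.Adj u v) * z v = 0)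
    (hzc : ∀ g : V → ZMod 2, ∑ v, g v * z v = ∑ u, g (c u))
    (hc : ∀ u v, G.Adj (c u) (c v) ↔ (SimpleGraph.cycleGraph (2 * n + 1)).Adj u v) :
    r2 G < 2 * k := by
  by_contra! hk
  have h0 := hB.partsMap_eq_zero hk hz
  have hL : ∀ i, ∑ u, ind (c u ∈ (B i).left) = 0 := fun i => by
    rw [← hzc fun v => ind (v ∈ (B i).left), ← partsMap_inl, h0, Pi.zero_apply]
  have h1 : ∑ u, ∑ v, ∑ i, ind (c u ∈ (B i).left) * ind (c v ∈ (B i).right) = 0 := by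
    calc _ = ∑ i, (∑ u, ind (c u ∈ (B i).left)) * ∑ v, ind (c v ∈ (B i).right) := by
          simp only [Finset.sum_mul_sum]
          rw [Finset.sum_comm (s := (Finset.univ : Finset (Fin k)))]
          exact Finset.sum_congr rfl fun u _ => Finset.sum_comm
      _ = 0 := by simp [hL]
  -- The same sum, taken over unordered pairs, is the number of edges `2 * n + 1`.
  rw [sum_eq_sum_ind_lt _ (fun u v => ind ((SimpleGraph.cycleGraph (2 * n + 1)).Adj u v)),
    sum_ind_lt_mul_cycleGraph_adj (by omega)] at h1
  · rw [ZMod.natCast_eq_zero_iff_even] at h1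
    exact Nat.not_even_bit1 n h1
  · exact fun u => Finset.sum_eq_zero fun i _ => (B i).ind_left_mul_ind_right _
  · intro u v
    rw [← ind_congr (hc u v), ← hB.coverSum_eq, coverSum, Finset.sum_add_distrib]

end LowerBound

/-! ### Kernel of the adjacency matrix of a cycle -/

/-- `f` is in the kernel of the adjacency matrix of the cycle `C_k`. -/
def CycleKer (k : ℕ) (f : Fin k → ZMod 2) : Prop :=
  ∀ u, ∑ v, ind ((SimpleGraph.cycleGraph k).Adj u v) * f v = 0

theorem sum_cycleGraph_adj_mul {k : ℕ} (f : Fin k → ZMod 2) {u a b : Fin k} (hab : a ≠ b)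
    (h : ∀ v, (SimpleGraph.cycleGraph k).Adj u v ↔ v = a ∨ v = b) :
    ∑ v, ind ((SimpleGraph.cycleGraph k).Adj u v) * f v = f a + f b := by
  classical
  rw [← Finset.sum_pair hab]
  rw [← Finset.sum_subset (Finset.subset_univ {a, b})]
  · refine Finset.sum_congr rfl fun v hv => ?_
    rw [ind_true ((h v).2 (by simpa using hv)), one_mul]
  · intro v _ hv
    rw [ind_false fun hh => hv (by simpa using (h v).1 hh), zero_mul]

/-- Each vertex forces its two neighbours to carry equal values; vertices `0` and `k - 1` give the
wrap-around conditions. -/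
theorem cycleKer_iff {k : ℕ} (hk : 3 ≤ k) (f : Fin k → ZMod 2) :
    CycleKer k f ↔ (∀ j (hj : j + 2 < k), f ⟨j + 2, hj⟩ = f ⟨j, by omega⟩) ∧
      f ⟨1, by omega⟩ = f ⟨k - 1, by omega⟩ ∧ f ⟨k - 2, by omega⟩ = f ⟨0, by omega⟩ := by
  have hadd : ∀ x y : ZMod 2, x + y = 0 ↔ x = y := by decide
  have hmid : ∀ j (hj : j + 2 < k),
      ∑ v, ind ((SimpleGraph.cycleGraph k).Adj ⟨j + 1, by omega⟩ v) * f v =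
        f ⟨j + 2, hj⟩ + f ⟨j, by omega⟩ := fun j hj =>
    sum_cycleGraph_adj_mul f (by simp) fun v => by
      rw [cycleGraph_adj_iff hk, Fin.ext_iff, Fin.ext_iff]
      have := v.2
      simp only
      omega
  have hfst : ∑ v, ind ((SimpleGraph.cycleGraph k).Adj ⟨0, by omega⟩ v) * f v =
        f ⟨1, by omega⟩ + f ⟨k - 1, by omega⟩ :=
    sum_cycleGraph_adj_mul f (by rw [Ne, Fin.ext_iff]; simp only; omega) fun v => by
      rw [cycleGraph_adj_iff hk, Fin.ext_iff, Fin.ext_iff]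
      have := v.2
      simp only [true_and]
      omega
  have hlst : ∑ v, ind ((SimpleGraph.cycleGraph k).Adj ⟨k - 1, by omega⟩ v) * f v =
        f ⟨k - 2, by omega⟩ + f ⟨0, by omega⟩ :=
    sum_cycleGraph_adj_mul f (by rw [Ne, Fin.ext_iff]; simp only; omega) fun v => by
      rw [cycleGraph_adj_iff hk, Fin.ext_iff, Fin.ext_iff]
      have := v.2
      simp only [and_true]
      omega
  constructor
  · intro h
    refine ⟨fun j hj => ?_, ?_, ?_⟩
    · rw [← hadd, ← hmid j hj, h]
    · rw [← hadd, ← hfst, h]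
    · rw [← hadd, ← hlst, h]
  · rintro ⟨h1, h2, h3⟩ u
    rcases (by omega : (u : ℕ) = 0 ∨ (u : ℕ) = k - 1 ∨
      (u : ℕ) = (u : ℕ) - 1 + 1 ∧ (u : ℕ) - 1 + 2 < k) with hu | hu | ⟨hu, hj⟩
    · rw [show u = ⟨0, by omega⟩ from Fin.ext hu, hfst, hadd, h2]
    · rw [show u = ⟨k - 1, by omega⟩ from Fin.ext hu, hlst, hadd, h3]
    · rw [show u = ⟨(u : ℕ) - 1 + 1, by omega⟩ from Fin.ext hu, hmid _ hj, hadd, h1]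

theorem CycleKer.eq_mod_two {k : ℕ} (hk : 3 ≤ k) {f : Fin k → ZMod 2} (h : CycleKer k f) :
    ∀ j (hj : j < k), f ⟨j, hj⟩ = f ⟨j % 2, by omega⟩ := by
  intro j
  induction j using Nat.strong_induction_on with
  | _ j ih =>
    intro hj
    rcases lt_or_ge j 2 with h2 | h2
    · congr 2; omega
    · obtain ⟨i, rfl⟩ := Nat.exists_eq_add_of_le' h2
      rw [((cycleKer_iff hk f).1 h).1 i hj, ih i (by omega)]
      congr 2; omega

theorem cycleKer_odd_iff {n : ℕ} (hn : 1 ≤ n) (f : Fin (2 * n + 1) → ZMod 2) :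
    CycleKer (2 * n + 1) f ↔ ∀ u, f u = f ⟨0, by omega⟩ := by
  constructor
  · intro h u
    have h1 := h.eq_mod_two (by omega)
    -- The condition at vertex `0` links `1` to the even position `2 * n`, merging the two parity
    -- classes.
    have h2 := ((cycleKer_iff (by omega) f).1 h).2.1
    have h3 : f ⟨1, by omega⟩ = f ⟨0, by omega⟩ := by
      rw [h2, h1 (2 * n + 1 - 1)]
      congr 2; omega
    rw [show f u = _ from h1 u u.2]
    rcases Nat.mod_two_eq_zero_or_one (u : ℕ) with hu | hu
    · congr 2
    · rw [← h3]; congr 2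
  · intro h
    rw [cycleKer_iff (by omega)]
    exact ⟨fun j hj => by rw [h, h ⟨j, _⟩], by rw [h, h ⟨2 * n + 1 - 1, _⟩], h _⟩

theorem cycleKer_even_iff {m : ℕ} (hm : 2 ≤ m) (f : Fin (2 * m) → ZMod 2) :
    CycleKer (2 * m) f ↔ ∀ u, f u = f ⟨(u : ℕ) % 2, by omega⟩ := by
  constructor
  · exact fun h u => h.eq_mod_two (by omega) u u.2
  · intro h
    rw [cycleKer_iff (by omega)]
    refine ⟨fun j hj => ?_, ?_, ?_⟩
    · rw [h, h ⟨j, _⟩]; congr 2; simp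
    · rw [h, h ⟨2 * m - 1, _⟩]; congr 2; simp only; omega
    · rw [h, h ⟨0, _⟩]; congr 2; simp only; omega

/-! ### Rank of a disjoint union of cycles -/

section Union

variable {t l : ℕ} (n : Fin t → ℕ) (m : Fin l → ℕ)

/-- The vertices of the disjoint union of cycles. -/
abbrev Vert := (Σ i : Fin t, Fin (2 * n i + 1)) ⊕ (Σ j : Fin l, Fin (2 * m j))

variable {n m}

theorem disjointUnion_adj {ι : Type*} {V : ι → Type*} (G : ∀ i, SimpleGraph (V i)) (i : ι)
    (u v : V i) : (disjointUnion G).Adj ⟨i, u⟩ ⟨i, v⟩ ↔ (G i).Adj u v := by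
  constructor
  · rintro ⟨j, u', v', h, hu, hv⟩
    cases hu
    cases hv
    exact h
  · exact fun h => ⟨i, u, v, h, rfl, rfl⟩

theorem not_disjointUnion_adj {ι : Type*} {V : ι → Type*} (G : ∀ i, SimpleGraph (V i))
    {i j : ι} (h : i ≠ j) (u : V i) (v : V j) : ¬ (disjointUnion G).Adj ⟨i, u⟩ ⟨j, v⟩ := by
  rintro ⟨k, u', v', -, hu, hv⟩
  cases hu
  cases hv
  exact h rfl

theorem sum_disjointUnion_adj {ι : Type*} [Fintype ι] {V : ι → Type*} [∀ i, Fintype (V i)]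
    (G : ∀ i, SimpleGraph (V i)) (f : (Σ i, V i) → ZMod 2) (i : ι) (u : V i) :
    ∑ w, ind ((disjointUnion G).Adj ⟨i, u⟩ w) * f w =
      ∑ v, ind ((G i).Adj u v) * f ⟨i, v⟩ := by
  rw [Fintype.sum_sigma, Finset.sum_eq_single i]
  · exact Finset.sum_congr rfl fun v _ => by rw [ind_congr (disjointUnion_adj G i u v)]
  · intro j _ hj
    exact Finset.sum_eq_zero fun v _ => by
      rw [ind_false (not_disjointUnion_adj G hj.symm u v), zero_mul]
  · simp

theorem sum_cycleUnion_adj_eq_zero_iff (f : Vert n m → ZMod 2) :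
    (∀ u, ∑ v, ind ((cycleUnion n m).Adj u v) * f v = 0) ↔
      (∀ i, CycleKer (2 * n i + 1) fun u => f (Sum.inl ⟨i, u⟩)) ∧
        ∀ j, CycleKer (2 * m j) fun u => f (Sum.inr ⟨j, u⟩) := by
  have hl : ∀ i u, ∑ v, ind ((cycleUnion n m).Adj (Sum.inl ⟨i, u⟩) v) * f v =
      ∑ v, ind ((SimpleGraph.cycleGraph (2 * n i + 1)).Adj u v) * f (Sum.inl ⟨i, v⟩) := by
    intro i u
    rw [Fintype.sum_sum_type, ← sum_disjointUnion_adj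
      (fun i => SimpleGraph.cycleGraph (2 * n i + 1)) (fun x => f (Sum.inl x))]
    simp [cycleUnion, ind_false]
  have hr : ∀ j u, ∑ v, ind ((cycleUnion n m).Adj (Sum.inr ⟨j, u⟩) v) * f v =
      ∑ v, ind ((SimpleGraph.cycleGraph (2 * m j)).Adj u v) * f (Sum.inr ⟨j, v⟩) := by
    intro i u
    rw [Fintype.sum_sum_type, ← sum_disjointUnion_adj
      (fun i => SimpleGraph.cycleGraph (2 * m i)) (fun x => f (Sum.inr x))]
    simp [cycleUnion, ind_false]
  constructor
  · intro h
    exact ⟨fun i u => by rw [← hl, h], fun j u => by rw [← hr, h]⟩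
  · rintro ⟨h1, h2⟩ (⟨i, u⟩ | ⟨j, u⟩)
    · rw [hl]; exact h1 i u
    · rw [hr]; exact h2 j u

/-- The kernel of the adjacency matrix consists of the functions that factor through this map. -/
def kerClass : Vert n m → Fin t ⊕ Fin l × Fin 2
  | Sum.inl ⟨i, _⟩ => Sum.inl i
  | Sum.inr ⟨j, u⟩ => Sum.inr (j, ⟨(u : ℕ) % 2, by omega⟩)

theorem mem_range_funLeft_kerClass (hn : ∀ i, 1 ≤ n i) (hm : ∀ j, 2 ≤ m j)
    (f : Vert n m → ZMod 2) :
    (∀ u, ∑ v, ind ((cycleUnion n m).Adj u v) * f v = 0) ↔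
      ∃ g : Fin t ⊕ Fin l × Fin 2 → ZMod 2, g ∘ kerClass = f := by
  rw [sum_cycleUnion_adj_eq_zero_iff]
  constructor
  · rintro ⟨h1, h2⟩
    refine ⟨Sum.elim (fun i => f (Sum.inl ⟨i, ⟨0, by omega⟩⟩))
      (fun x => f (Sum.inr ⟨x.1, ⟨x.2, by have := hm x.1; omega⟩⟩)), ?_⟩
    funext x
    rcases x with ⟨i, u⟩ | ⟨j, u⟩
    · exact ((cycleKer_odd_iff (hn i) _).1 (h1 i) u).symm
    · exact ((cycleKer_even_iff (hm j) _).1 (h2 j) u).symm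
  · rintro ⟨g, rfl⟩
    refine ⟨fun i => (cycleKer_odd_iff (hn i) _).2 fun u => rfl,
      fun j => (cycleKer_even_iff (hm j) _).2 fun u => ?_⟩
    simp [kerClass]

theorem kerClass_surjective (hm : ∀ j, 2 ≤ m j) :
    Function.Surjective (kerClass : Vert n m → _) := by
  rintro (i | ⟨j, b⟩)
  · exact ⟨Sum.inl ⟨i, ⟨0, by omega⟩⟩, rfl⟩
  · refine ⟨Sum.inr ⟨j, ⟨b, by have := hm j; omega⟩⟩, ?_⟩
    simp only [kerClass, Sum.inr.injEq, Prod.mk.injEq, true_and]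
    exact Fin.ext (Nat.mod_eq_of_lt b.2)

/-- Rank-nullity: the kernel has dimension `t + 2 * l`, one for each value of `kerClass`. -/
theorem r2_cycleUnion (hn : ∀ i, 1 ≤ n i) (hm : ∀ j, 2 ≤ m j) :
    r2 (cycleUnion n m) + 2 * l = 2 * (∑ i, n i + ∑ j, m j) := by
  classical
  have h1 := LinearMap.finrank_range_add_finrank_ker
    ((cycleUnion n m).adjMatrix (ZMod 2)).mulVecLin
  have h2 : LinearMap.ker ((cycleUnion n m).adjMatrix (ZMod 2)).mulVecLin =
      LinearMap.range (LinearMap.funLeft (ZMod 2) (ZMod 2) (kerClass : Vert n m → _)) := by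
    ext f
    rw [LinearMap.mem_ker, LinearMap.mem_range]
    refine Iff.trans ?_ (mem_range_funLeft_kerClass hn hm f)
    rw [funext_iff]
    refine forall_congr' fun u => ?_
    rw [Matrix.mulVecLin_apply, ← adjMatrix_mulVec_apply, Pi.zero_apply]
  rw [h2, LinearMap.finrank_range_of_inj
    (LinearMap.funLeft_injective_of_surjective _ _ _ (kerClass_surjective hm)),
    Module.finrank_pi, Module.finrank_pi] at h1
  have h3 : r2 (cycleUnion n m) = Module.finrank (ZMod 2)
      (LinearMap.range ((cycleUnion n m).adjMatrix (ZMod 2)).mulVecLin) := by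
    unfold r2 Matrix.rank
    convert rfl
  rw [← h3] at h1
  simp only [Fintype.card_sum, Fintype.card_sigma, Fintype.card_prod, Fintype.card_fin,
    Finset.sum_add_distrib, ← Finset.mul_sum, Finset.sum_const, Finset.card_univ,
    smul_eq_mul] at h1
  omega

theorem r2_cycleUnion_lt (ht : 1 ≤ t) (hn : ∀ i, 1 ≤ n i) (hm : ∀ j, 2 ≤ m j) {k : ℕ}
    {B : Fin k → Biclique (Vert n m)} (hB : IsOddCover (cycleUnion n m) B) :
    r2 (cycleUnion n m) < 2 * k := by
  let i₀ : Fin t := ⟨0, ht⟩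
  refine hB.r2_lt (hn i₀) (fun u => Sum.inl ⟨i₀, u⟩) ((fun x => ind (x = Sum.inl i₀)) ∘ kerClass)
    ((mem_range_funLeft_kerClass hn hm _).2 ⟨_, rfl⟩) (fun g => ?_) fun u v => ?_
  · rw [Fintype.sum_sum_type, Fintype.sum_sigma, Finset.sum_eq_single i₀]
    · simp [kerClass, ind]
    · intro i _ hi
      simp [kerClass, ind, hi]
    · simp
  · simp only [cycleUnion, SimpleGraph.sum_adj_inl]
    exact disjointUnion_adj (fun i => SimpleGraph.cycleGraph (2 * n i + 1)) i₀ u v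

end Union

/-! ### The explicit odd cover -/

section UpperBound

variable {t l : ℕ} {n : Fin t → ℕ} {m : Fin l → ℕ}

/-- The cycle that contains a vertex. -/
def cyc : Vert n m → Fin t ⊕ Fin l := Sum.map Sigma.fst Sigma.fst

/-- The position of a vertex on its cycle. -/
def pos : Vert n m → ℕ := Sum.elim (fun x => x.2) fun x => x.2

variable (n m) in
/-- The biclique between the vertices `0` and the vertices `1` of the odd cycles. -/
def globalBiclique : Biclique (Vert n m) where
  left := {x | (cyc x).isLeft ∧ pos x = 0}
  right := {x | (cyc x).isLeft ∧ pos x = 1}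
  disjoint := Set.disjoint_left.2 fun x hx hy => by
    simp only [Set.mem_ofPred_eq] at hx hy
    omega

variable (n m) in
/-- The biclique joining the vertices `0, 1` of the odd cycle `i` with its vertex `2` and with the
vertices `1` of the other odd cycles. -/
def fanBiclique (i : Fin t) : Biclique (Vert n m) where
  left := {x | (cyc x = Sum.inl i ∧ pos x = 2) ∨
    ((cyc x).isLeft ∧ cyc x ≠ Sum.inl i) ∧ pos x = 1}
  right := {x | cyc x = Sum.inl i ∧ (pos x = 0 ∨ pos x = 1)}
  disjoint := Set.disjoint_left.2 fun x hx hy => by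
    simp only [Set.mem_ofPred_eq] at hx hy
    rcases hx with hx | hx
    · omega
    · exact hx.1.2 hy.1

variable (n m) in
/-- The four-cycle on the vertices `0, a + 1, a + 2, a + 3` of the cycle `c`. -/
def squareBiclique (c : Fin t ⊕ Fin l) (a : ℕ) : Biclique (Vert n m) where
  left := {x | cyc x = c ∧ (pos x = 0 ∨ pos x = a + 2)}
  right := {x | cyc x = c ∧ (pos x = a + 1 ∨ pos x = a + 3)}
  disjoint := Set.disjoint_left.2 fun x hx hy => by
    simp only [Set.mem_ofPred_eq] at hx hy
    omega

/-- The index type of an odd cover of the disjoint union of cycles. -/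
abbrev CoverIndex (n : Fin t → ℕ) (m : Fin l → ℕ) :=
  Option (Fin t) ⊕ ((Σ i : Fin t, Fin (n i - 1)) ⊕ (Σ j : Fin l, Fin (m j - 1)))

variable (n m) in
/-- An odd cover of the disjoint union of cycles. -/
def cycleCover : CoverIndex n m → Biclique (Vert n m)
  | Sum.inl none => globalBiclique n m
  | Sum.inl (some i) => fanBiclique n m i
  | Sum.inr (Sum.inl ⟨i, s⟩) => squareBiclique n m (Sum.inl i) (2 * s + 1)
  | Sum.inr (Sum.inr ⟨j, s⟩) => squareBiclique n m (Sum.inr j) (2 * s)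

/-- The shift to `a + 1` keeps the path away from the apex `0`, so the parts stay disjoint for every
`a`. -/
theorem ind_squareBiclique (c : Fin t ⊕ Fin l) (a : ℕ) (x y : Vert n m) :
    ind (x ∈ (squareBiclique n m c a).left) * ind (y ∈ (squareBiclique n m c a).right) +
      ind (y ∈ (squareBiclique n m c a).left) * ind (x ∈ (squareBiclique n m c a).right) =
    ind (cyc x = c) * (ind (cyc y = c) * fourCycle (a + 1) (pos x) (pos y)) := by
  simp only [squareBiclique, Set.mem_ofPred_eq]
  rw [ind_and, ind_and, ind_and, ind_and, ind_or (by omega), ind_or (by omega),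
    ind_or (by omega), ind_or (by omega), fourCycle]
  ring

theorem ind_globalBiclique (x y : Vert n m) :
    ind (x ∈ (globalBiclique n m).left) * ind (y ∈ (globalBiclique n m).right) +
      ind (y ∈ (globalBiclique n m).left) * ind (x ∈ (globalBiclique n m).right) =
    ind (cyc x).isLeft * ind (cyc y).isLeft * edge 0 1 (pos x) (pos y) := by
  simp only [globalBiclique, Set.mem_ofPred_eq, ind_and, edge]
  ring

theorem ind_fanBiclique (i : Fin t) (x y : Vert n m) :
    ind (x ∈ (fanBiclique n m i).left) * ind (y ∈ (fanBiclique n m i).right) =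
    ind (Sum.inl i = cyc y) * ((ind (Sum.inl i = cyc x) * ind (pos x = 2) +
      ind (cyc x).isLeft * (1 - ind (Sum.inl i = cyc x)) * ind (pos x = 1)) *
        (ind (pos y = 0) + ind (pos y = 1))) := by
  simp only [fanBiclique, Set.mem_ofPred_eq, eq_comm (a := (Sum.inl i : Fin t ⊕ Fin l))]
  rw [ind_or (by omega), ind_and, ind_and, ind_and, ind_and, ind_or (by omega), Ne, ind_not]
  ring

theorem coverSum_cycleCover (x y : Vert n m) :
    coverSum (cycleCover n m) x y =
      ind (cyc x).isLeft * ind (cyc y).isLeft * edge 0 1 (pos x) (pos y) +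
      (∑ i : Fin t, ind (Sum.inl i = cyc y) * ((ind (Sum.inl i = cyc x) * ind (pos x = 2) +
        ind (cyc x).isLeft * (1 - ind (Sum.inl i = cyc x)) * ind (pos x = 1)) *
          (ind (pos y = 0) + ind (pos y = 1))) +
      ∑ i : Fin t, ind (Sum.inl i = cyc x) * ((ind (Sum.inl i = cyc y) * ind (pos y = 2) +
        ind (cyc y).isLeft * (1 - ind (Sum.inl i = cyc y)) * ind (pos y = 1)) *
          (ind (pos x = 0) + ind (pos x = 1)))) +
      (∑ i : Fin t, ind (Sum.inl i = cyc x) * (ind (Sum.inl i = cyc y) *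
        ∑ s ∈ Finset.range (n i - 1), fourCycle (2 * s + 2) (pos x) (pos y)) +
      ∑ j : Fin l, ind (Sum.inr j = cyc x) * (ind (Sum.inr j = cyc y) *
        ∑ s ∈ Finset.range (m j - 1), fourCycle (2 * s + 1) (pos x) (pos y))) := by
  rw [coverSum, Fintype.sum_sum_type, Fintype.sum_sum_type, Fintype.sum_option,
    Fintype.sum_sigma, Fintype.sum_sigma]
  simp only [cycleCover, ind_squareBiclique, ind_globalBiclique, ind_fanBiclique,
    Finset.sum_add_distrib, ← Finset.mul_sum]
  congr 1
  congr 1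
  · refine Finset.sum_congr rfl fun i _ => ?_
    rw [← Fin.sum_univ_eq_sum_range (fun s => fourCycle (2 * s + 2) (pos x) (pos y)),
      eq_comm (a := cyc x), eq_comm (a := cyc y)]
  · refine Finset.sum_congr rfl fun i _ => ?_
    rw [← Fin.sum_univ_eq_sum_range (fun s => fourCycle (2 * s + 1) (pos x) (pos y)),
      eq_comm (a := cyc x), eq_comm (a := cyc y)]

/-- Within an odd cycle the global biclique gives edge `0, 1` and the fan gives `0, 2` and `1, 2`: a
triangle, which the squares extend. Between two odd cycles, the pairs `0, 1` arise once globally and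
once from a fan, and the pair `1, 1` from both fans, so all cancel. -/
theorem coverSum_cycleCover_eq (hn : ∀ i, 1 ≤ n i) (hm : ∀ j, 2 ≤ m j) (x y : Vert n m) :
    coverSum (cycleCover n m) x y = ind ((cycleUnion n m).Adj x y) := by
  have hinl : ∀ a b : Fin t, ind ((Sum.inl a : Fin t ⊕ Fin l) = Sum.inl b) = ind (a = b) :=
    fun a b => ind_congr Sum.inl_injective.eq_iff
  have hinr : ∀ a b : Fin l, ind ((Sum.inr a : Fin t ⊕ Fin l) = Sum.inr b) = ind (a = b) :=
    fun a b => ind_congr Sum.inr_injective.eq_iff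
  have hlr : ∀ a b, ind ((Sum.inl a : Fin t ⊕ Fin l) = Sum.inr b) = 0 :=
    fun a b => ind_false Sum.inl_ne_inr
  have hrl : ∀ a b, ind ((Sum.inr a : Fin t ⊕ Fin l) = Sum.inl b) = 0 :=
    fun a b => ind_false Sum.inr_ne_inl
  have hl : ∀ a, ind ((Sum.inl a : Fin t ⊕ Fin l).isLeft = true) = 1 := fun a => ind_true rfl
  have hr : ∀ a, ind ((Sum.inr a : Fin t ⊕ Fin l).isLeft = true) = 0 :=
    fun a => ind_false (by simp)
  rw [coverSum_cycleCover]
  rcases x with ⟨i, u⟩ | ⟨i, u⟩ <;> rcases y with ⟨j, v⟩ | ⟨j, v⟩ <;>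
    simp only [cyc, pos, Sum.map_inl, Sum.map_inr, Sum.elim_inl, Sum.elim_inr, hinl, hinr, hlr,
      hrl, hl, hr, zero_mul, mul_zero, Finset.sum_const_zero, add_zero, zero_add,
      sum_ind_eq_mul, ind_true (Finset.mem_univ _), one_mul, cycleUnion,
      SimpleGraph.sum_adj_inl, SimpleGraph.sum_adj_inr]
  · rcases eq_or_ne i j with rfl | hij
    · have h := hn i
      rw [ind_true rfl, ind_congr
        (disjointUnion_adj (fun i => SimpleGraph.cycleGraph (2 * n i + 1)) i u v),
        ind_cycleGraph_adj (by omega),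
        show 2 * n i + 1 - 1 = 2 * (n i - 1) + 2 by omega, ← sum_fourCycle_odd]
      unfold edge
      ring
    · rw [ind_false hij, ind_false hij.symm,
        ind_false (not_disjointUnion_adj (fun i => SimpleGraph.cycleGraph (2 * n i + 1)) hij u v)]
      unfold edge
      linear_combination (ind ((u : ℕ) = 0) * ind ((v : ℕ) = 1) +
        ind ((v : ℕ) = 0) * ind ((u : ℕ) = 1) +
        ind ((u : ℕ) = 1) * ind ((v : ℕ) = 1)) * two_eq_zero
  · exact (ind_false (by simp)).symm
  · exact (ind_false (by simp)).symm
  · rcases eq_or_ne i j with rfl | hij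
    · have h := hm i
      rw [ind_true rfl, ind_congr
        (disjointUnion_adj (fun j => SimpleGraph.cycleGraph (2 * m j)) i u v),
        ind_cycleGraph_adj (by omega),
        show 2 * m i - 1 = 2 * (m i - 1) + 1 by omega, ← sum_fourCycle_even, one_mul]
    · rw [ind_false hij,
        ind_false (not_disjointUnion_adj (fun j => SimpleGraph.cycleGraph (2 * m j)) hij u v),
        zero_mul]

theorem card_coverIndex (hn : ∀ i, 1 ≤ n i) (hm : ∀ j, 2 ≤ m j) :
    Fintype.card (CoverIndex n m) + l = ∑ i, n i + ∑ j, m j + 1 := by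
  have h1 : ∑ i, (n i - 1) + t = ∑ i, n i := by
    rw [← Finset.sum_congr rfl fun i _ => Nat.sub_add_cancel (hn i), Finset.sum_add_distrib]
    simp
  have h2 : ∑ j, (m j - 1) + l = ∑ j, m j := by
    rw [← Finset.sum_congr rfl fun j _ => Nat.sub_add_cancel (one_le_two.trans (hm j)),
      Finset.sum_add_distrib]
    simp
  simp only [Fintype.card_sum, Fintype.card_option, Fintype.card_sigma, Fintype.card_fin]
  omega

/-- The rank is even, so the strict bound `r2 < 2 * k` gains a full 1 over `r2 / 2`, matching the
size of the cover. -/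
theorem b2_cycleUnion (ht : 1 ≤ t) (hn : ∀ i, 1 ≤ n i) (hm : ∀ j, 2 ≤ m j) :
    b2 (cycleUnion n m) + l = ∑ i, n i + ∑ j, m j + 1 := by
  have hex := exists_isOddCover_of_coverSum (cycleUnion n m) (cycleCover n m)
    fun u v _ => coverSum_cycleCover_eq hn hm u v
  have hle : b2 (cycleUnion n m) ≤ Fintype.card (CoverIndex n m) := Nat.sInf_le hex
  obtain ⟨B, hB⟩ : ∃ B : Fin (b2 (cycleUnion n m)) → Biclique (Vert n m),
      IsOddCover (cycleUnion n m) B :=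
    Nat.sInf_mem (s := {k | ∃ B : Fin k → Biclique (Vert n m), IsOddCover (cycleUnion n m) B})
      ⟨_, hex⟩
  have h1 := r2_cycleUnion_lt ht hn hm hB
  have h2 := r2_cycleUnion hn hm
  have h3 := card_coverIndex hn hm
  omega

end UpperBound

end OddCover

theorem mainTheorem4 (t l : ℕ) (ht : 1 ≤ t) (n : Fin t → ℕ) (m : Fin l → ℕ)
    (hn : ∀ i, 1 ≤ n i) (hm : ∀ j, 2 ≤ m j) :
    (OddCover.b2 (OddCover.cycleUnion n m) : ℤ) =
        (∑ i, (n i : ℤ)) + (∑ j, (m j : ℤ)) - (l : ℤ) + 1 ∧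
      (OddCover.b2 (OddCover.cycleUnion n m) : ℚ) =
        (OddCover.r2 (OddCover.cycleUnion n m) : ℚ) / 2 + 1 := by
  have h1 := OddCover.b2_cycleUnion ht hn hm
  have h2 := OddCover.r2_cycleUnion hn hm
  constructor
  · zify at h1
    linarith
  · qify at h1 h2
    linarith
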